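/- Let $R=\mathbf{C}[z_1,\dots,z_d]$ with $d\ge 1$, and let $\mathbf{m}=(z_1,\dots,z_d)$ be the ideal of the origin, with $\mathbf{m}^k=R$ for $k\le 0$. For a $\mathbf{Z}^{\rho}$-graded system of ideals $\mathbf{a}_\bullet=\{\mathbf{a}_v\}_{v\in\mathbf{Z}^\rho}$ of $R$ (i.e. $\mathbf{a}_v\mathbf{a}_w\subseteq\mathbf{a}_{v+w}$) let $\mathrm{Nef}(\mathbf{a}_\bullet)\subseteq\mathbf{R}^\rho$ be the closed convex cone spanned by the $v$ with $\mathbf{a}_v=(1)$, and $\mathrm{Big}(\mathbf{a}_\bullet)$ the interior of the closed convex cone spanned by the $v$ with $\mathbf{a}_v\ne 0$. The asymptotic invariants of $\mathbf{a}_\bullet$ at $v\in\mathbf{Z}^\rho$ are $$\mathrm{ord}_0(v)=\lim_n\frac{\mathrm{ord}_0(\mathbf{a}_{nv})}{n},\qquad \mathrm{Arn}(v)=\lim_n\frac{\mathrm{Arn}(\mathbf{a}_{nv})}{n},\qquad e_0(v)=\lim_n\frac{e_0(\mathbf{a}_{nv})}{n^d},$$ where $\mathrm{ord}_0$ is the order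 of vanishing at the origin, $\mathrm{Arn}$ the reciprocal of the log-canonical threshold, and $e_0$ the Samuel multiplicity at the origin; $e_0(v)$ is considered only when $\mathbf{a}_{nv}$ is supported exactly at the origin for all $n\gg 0$. They are extended to rational $v$ by homogeneity (of degree $1$, $1$, $d$) and to real points by continuity: $\mathrm{ord}_0$ and $\mathrm{Arn}$ on $\mathrm{Big}(\mathbf{a}_\bullet)$, and $e_0$ on $\mathrm{Big}(\mathbf{a}_\bullet)\setminus\mathrm{Nef}(\mathbf{a}_\bullet)$. (1) There is a nonnegative, convex, positively homogeneous function $f:\mathbf{R}^2\to\mathbf{R}$ that is not differentiable on any nonempty open subset of $\mathbf{R}^2$. (2) Let $f:\mathbf{R}^n\to\mathbf{R}$ be nonnegative, convex and positively homogeneous, and suppose that $f$ is not $C^\infty$ on any nonempty open subset of $\mathbf{R}^n$. Let $C=\{(x,y)\in\mathbf{R}^{n}\times\mathbf{R} : y\ge f(x)\}$. Then $$\mathbf{a}_{(x,y)}=\mathbf{m}^{\lceil f(x)-y\rceil}\qquad((x,y)\in\mathbf{Z}^n\times\mathbf{Z})$$ defines a $\mathbf{Z}^{n+1}$-graded system $\mathbf{a}_\bullet=\mathbf{m}^C_\bullet$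 of ideals of $R$ with $\mathrm{Nef}(\mathbf{a}_\bullet)=C$ and $\mathrm{Big}(\mathbf{a}_\bullet)=\mathbf{R}^{n+1}$, so that $\mathrm{Big}(\mathbf{a}_\bullet)\setminus\mathrm{Nef}(\mathbf{a}_\bullet)$ is open and nonempty. The three asymptotic invariants of $\mathbf{a}_\bullet$ exist on the regions above, and at every point $(x,y)\in\mathrm{Big}(\mathbf{a}_\bullet)\setminus\mathrm{Nef}(\mathbf{a}_\bullet)$ $$\mathrm{ord}_0(x,y)=f(x)-y,\qquad \mathrm{Arn}(x,y)=\frac{f(x)-y}{d},\qquad e_0(x,y)=(f(x)-y)^d .$$ None of these three functions is $C^\infty$ on any nonempty open subset of $\mathrm{Big}(\mathbf{a}_\bullet)\setminus\mathrm{Nef}(\mathbf{a}_\bullet)$. -/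

import Mathlib

open Set Filter Topology MeasureTheory
open scoped ENNReal

noncomputable section

/-- A `ℤ^ρ`-graded system of ideals of the commutative ring `R`. -/
structure GradedSystem (ρ : ℕ) (R : Type*) [CommRing R] where
  /-- the ideal of index `v` -/
  ideal : (Fin ρ → ℤ) → Ideal R
  mul_le : ∀ v w, ideal v * ideal w ≤ ideal (v + w)

/-- The closed convex cone (with vertex at the origin) spanned by a set of integral vectors,
inside `ℤ^ρ ⊗ ℝ = ℝ^ρ`. -/
def closedConeSpan {ρ : ℕ} (S : Set (Fin ρ → ℤ)) : Set (Fin ρ → ℝ) :=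
  closure (PointedCone.hull ℝ ((fun (v : Fin ρ → ℤ) (i : Fin ρ) => (v i : ℝ)) '' S) :
    Set (Fin ρ → ℝ))

namespace GradedSystem

variable {ρ : ℕ} {R : Type*} [CommRing R]

/-- The nef cone: the closed convex cone spanned by the indices `v` with `𝔞_v = (1)`. -/
def nef (a : GradedSystem ρ R) : Set (Fin ρ → ℝ) :=
  closedConeSpan {v | a.ideal v = ⊤}

/-- The (closed) effective cone: the closed convex cone spanned by the `v` with `𝔞_v ≠ 0`. -/
def eff (a : GradedSystem ρ R) : Set (Fin ρ → ℝ) :=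
  closedConeSpan {v | a.ideal v ≠ ⊥}

/-- The big cone: the interior of the effective cone. -/
def big (a : GradedSystem ρ R) : Set (Fin ρ → ℝ) :=
  interior a.eff

/-- Let `φ` be an invariant of ideals. For `v ∈ ℤ^ρ`, the asymptotic invariant of `a` at `v` is
`lim_{n → ∞} φ(𝔞_{nv}) / n ^ k`. It is homogeneous of degree `k`, so that its value at a rational
class `v / q` is its value at `v` divided by `q ^ k`.

`a.IsAsymptotic φ k D F` says that `F` is this asymptotic invariant on the region `D`: the limits
exist at all rational points of `D`, `F` takes the right values there, and `F` is the continuous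
extension to the real points of `D`. The values of `F` outside `D` are irrelevant. -/
structure IsAsymptotic (a : GradedSystem ρ R) (φ : Ideal R → ℝ≥0∞) (k : ℕ)
    (D : Set (Fin ρ → ℝ)) (F : (Fin ρ → ℝ) → ℝ) : Prop where
  continuousOn : ContinuousOn F D
  nonneg : ∀ p ∈ D, 0 ≤ F p
  tendsto : ∀ (v : Fin ρ → ℤ) (q : ℕ), 0 < q → (fun i => (v i : ℝ) / q) ∈ D →
    Tendsto (fun n : ℕ => φ (a.ideal (n • v)) / (n : ℝ≥0∞) ^ k) atTop
      (𝓝 (ENNReal.ofReal ((q : ℝ) ^ k * F (fun i => (v i : ℝ) / q))))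

end GradedSystem

/-- The `n`-th symbolic power of the prime ideal `p`. -/
def symbolicPower {R : Type*} [CommRing R] (p : Ideal R) [p.IsPrime] (n : ℕ) : Ideal R :=
  ((p.map (algebraMap R (Localization.AtPrime p))) ^ n).comap
    (algebraMap R (Localization.AtPrime p))

/-- The order of vanishing of `I` along the subvariety with prime ideal `p`:
the largest `n` such that `I` is contained in the `n`-th symbolic power of `p`. -/
def ordAlong {R : Type*} [CommRing R] (p : Ideal R) [p.IsPrime] (I : Ideal R) : ℝ≥0∞ :=
  ⨆ (n : ℕ) (_ : I ≤ symbolicPower p n), (n : ℝ≥0∞)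

/-- The coordinate ring of affine `d`-space over `ℂ`. -/
abbrev AffRing (d : ℕ) : Type := MvPolynomial (Fin d) ℂ

/-- The ideal `(z_1, …, z_d)` of the origin of `ℂ^d`. -/
def originIdeal (d : ℕ) : Ideal (AffRing d) := Ideal.span (range MvPolynomial.X)

theorem originIdeal_eq_ker (d : ℕ) :
    originIdeal d = RingHom.ker (MvPolynomial.constantCoeff : AffRing d →+* ℂ) := by
  ext f
  have h := (MvPolynomial.mem_pow_idealOfVars_iff' (σ := Fin d) (R := ℂ) 1 f)
  rw [pow_one] at h
  rw [originIdeal, h, RingHom.mem_ker, MvPolynomial.constantCoeff_eq]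
  constructor
  · intro H
    exact H 0 (by simp)
  · intro H x hx
    have hx0 : x = 0 := by
      rw [← Finsupp.degree_eq_zero_iff]; omega
    rw [hx0]; exact H

instance originIdeal_isPrime (d : ℕ) : (originIdeal d).IsPrime := by
  rw [originIdeal_eq_ker]
  exact RingHom.ker_isPrime _

/-- The order of vanishing at the origin of an ideal on `ℂ^d`. -/
def ord₀ {d : ℕ} (I : Ideal (AffRing d)) : ℝ≥0∞ := ordAlong (originIdeal d) I

/-- The Samuel multiplicity at the origin of an ideal on `ℂ^d`, that is
`lim_n length (𝒪 / I ^ n 𝒪) / (n ^ d / d!)` with `𝒪` the local ring at the origin (of dimension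
`d`). For an ideal of finite colength in `𝒪` the limit exists, so that the upper limit is
the limit. -/
def samuelMult₀ {d : ℕ} (I : Ideal (AffRing d)) : ℝ≥0∞ :=
  limsup (fun n : ℕ =>
    ((Module.length (Localization.AtPrime (originIdeal d))
      (Localization.AtPrime (originIdeal d) ⧸
        (I.map (algebraMap (AffRing d) (Localization.AtPrime (originIdeal d)))) ^ n) : ℕ∞) :
          ℝ≥0∞) / ((n : ℝ≥0∞) ^ d / (Nat.factorial d : ℝ≥0∞))) atTop

/-- The weight `|h|² / (∑_{g ∈ S} |g|²) ^ c` at the point `z ∈ ℂ^d`, in `[0, ∞]`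
(with the convention `0 / 0 = 0`). -/
def multiplierWeight {d : ℕ} (c : ℝ) (S : Finset (AffRing d)) (h : AffRing d)
    (z : Fin d → ℂ) : ℝ≥0∞ :=
  ‖MvPolynomial.eval z h‖ₑ ^ 2 / (∑ g ∈ S, ‖MvPolynomial.eval z g‖ₑ ^ 2) ^ c

theorem continuous_enorm_eval_sq {d : ℕ} (h : AffRing d) :
    Continuous fun z : Fin d → ℂ => ‖MvPolynomial.eval z h‖ₑ ^ 2 := by
  have h1 : Continuous fun z : Fin d → ℂ => MvPolynomial.eval z h := MvPolynomial.continuous_eval h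
  fun_prop

theorem measurable_multiplierWeight {d : ℕ} (c : ℝ) (S : Finset (AffRing d)) (h : AffRing d) :
    Measurable (multiplierWeight c S h) := by
  unfold multiplierWeight
  have h1 := (continuous_enorm_eval_sq h).measurable
  have h2 : Measurable fun z : Fin d → ℂ => ∑ g ∈ S, ‖MvPolynomial.eval z g‖ₑ ^ 2 :=
    Finset.measurable_sum _ fun g _ => (continuous_enorm_eval_sq g).measurable
  exact h1.div (h2.pow_const c)

/-- The multiplier ideal `𝒥(ℂ^d, c · I)`: the polynomials `h` such that, for generators
`g_1, …, g_r` of `I`, the function `|h|² / (|g_1|² + ⋯ + |g_r|²) ^ c` is locally integrable. (The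
condition does not depend on the choice of the generators.) -/
def multiplierIdeal {d : ℕ} (c : ℝ) (I : Ideal (AffRing d)) : Ideal (AffRing d) where
  carrier := {h | ∀ S : Finset (AffRing d), Ideal.span (S : Set (AffRing d)) = I →
    ∀ x : Fin d → ℂ, ∃ U ∈ 𝓝 x, (∫⁻ z in U, multiplierWeight c S h z) < ∞}
  zero_mem' := by
    intro S _ x
    exact ⟨univ, univ_mem, by simp [multiplierWeight]⟩
  add_mem' := by
    intro h₁ h₂ H₁ H₂ S hS x
    obtain ⟨U, hU, hU'⟩ := H₁ S hS x
    obtain ⟨V, hV, hV'⟩ := H₂ S hS x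
    refine ⟨U ∩ V, inter_mem hU hV, ?_⟩
    have key : ∀ z, multiplierWeight c S (h₁ + h₂) z ≤
        2 * multiplierWeight c S h₁ z + 2 * multiplierWeight c S h₂ z := by
      intro z
      unfold multiplierWeight
      rw [← mul_div_assoc, ← mul_div_assoc, ← ENNReal.add_div]
      gcongr
      rw [map_add]
      calc ‖MvPolynomial.eval z h₁ + MvPolynomial.eval z h₂‖ₑ ^ 2
          ≤ (‖MvPolynomial.eval z h₁‖ₑ + ‖MvPolynomial.eval z h₂‖ₑ) ^ 2 := by
            gcongr; exact enorm_add_le _ _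
        _ ≤ 2 * ‖MvPolynomial.eval z h₁‖ₑ ^ 2 + 2 * ‖MvPolynomial.eval z h₂‖ₑ ^ 2 := by
            have h := add_sq_le (a := ‖MvPolynomial.eval z h₁‖₊) (b := ‖MvPolynomial.eval z h₂‖₊)
            rw [mul_add] at h
            simp only [enorm_eq_nnnorm]
            exact_mod_cast h
    calc ∫⁻ z in U ∩ V, multiplierWeight c S (h₁ + h₂) z
        ≤ ∫⁻ z in U ∩ V, (2 * multiplierWeight c S h₁ z + 2 * multiplierWeight c S h₂ z) :=
          lintegral_mono key
      _ = 2 * (∫⁻ z in U ∩ V, multiplierWeight c S h₁ z) +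
            2 * ∫⁻ z in U ∩ V, multiplierWeight c S h₂ z := by
          rw [lintegral_add_left ((measurable_multiplierWeight c S h₁).const_mul 2),
            lintegral_const_mul _ (measurable_multiplierWeight c S h₁),
            lintegral_const_mul _ (measurable_multiplierWeight c S h₂)]
      _ ≤ 2 * (∫⁻ z in U, multiplierWeight c S h₁ z) +
            2 * ∫⁻ z in V, multiplierWeight c S h₂ z := by
          gcongr
          · exact inter_subset_left
          · exact inter_subset_right
      _ < ∞ := ENNReal.add_lt_top.2
          ⟨ENNReal.mul_lt_top (by simp) hU', ENNReal.mul_lt_top (by simp) hV'⟩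
  smul_mem' := by
    intro f h H S hS x
    obtain ⟨U, hU, hU'⟩ := H S hS x
    set M : ℝ≥0∞ := ‖MvPolynomial.eval x f‖ₑ ^ 2 + 1 with hM
    have hMtop : M < ∞ := by simp [hM]
    have hlt : ‖MvPolynomial.eval x f‖ₑ ^ 2 < M :=
      ENNReal.lt_add_right (by simp) one_ne_zero
    have hV : {z | ‖MvPolynomial.eval z f‖ₑ ^ 2 < M} ∈ 𝓝 x :=
      (continuous_enorm_eval_sq f).continuousAt.eventually_lt continuousAt_const hlt
    have hVm : MeasurableSet {z : Fin d → ℂ | ‖MvPolynomial.eval z f‖ₑ ^ 2 < M} :=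
      measurableSet_lt (continuous_enorm_eval_sq f).measurable measurable_const
    refine ⟨U ∩ {z | ‖MvPolynomial.eval z f‖ₑ ^ 2 < M}, inter_mem hU hV, ?_⟩
    rw [inter_comm, ← Measure.restrict_restrict hVm]
    calc ∫⁻ z in {z | ‖MvPolynomial.eval z f‖ₑ ^ 2 < M}, multiplierWeight c S (f • h) z
          ∂(volume.restrict U)
        ≤ ∫⁻ z in {z | ‖MvPolynomial.eval z f‖ₑ ^ 2 < M}, M * multiplierWeight c S h z
          ∂(volume.restrict U) := by
          refine setLIntegral_mono' hVm fun z hz => ?_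
          unfold multiplierWeight
          rw [smul_eq_mul, map_mul, enorm_mul, mul_pow, mul_div_assoc]
          gcongr
          exact le_of_lt hz
      _ ≤ ∫⁻ z in U, M * multiplierWeight c S h z := setLIntegral_le_lintegral _ _
      _ = M * ∫⁻ z in U, multiplierWeight c S h z :=
          lintegral_const_mul _ (measurable_multiplierWeight c S h)
      _ < ∞ := ENNReal.mul_lt_top hMtop hU'

/-- The log-canonical threshold `c(I) = inf {c > 0 | 𝒥(ℂ^d, c · I) ≠ 𝒪}`, in `[0, ∞]`. -/
def lct {d : ℕ} (I : Ideal (AffRing d)) : ℝ≥0∞ :=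
  ⨅ (c : ℝ) (_ : 0 < c ∧ multiplierIdeal c I ≠ ⊤), ENNReal.ofReal c

/-- The Arnold multiplicity `Arn(I) = 1 / c(I)`. -/
def arn {d : ℕ} (I : Ideal (AffRing d)) : ℝ≥0∞ := (lct I)⁻¹

namespace GradedSystem

variable {ρ d : ℕ}

/-- `F` is the asymptotic order of vanishing at the origin of `a`, on its big cone. -/
def IsAsymptoticOrd (a : GradedSystem ρ (AffRing d)) (F : (Fin ρ → ℝ) → ℝ) : Prop :=
  a.IsAsymptotic ord₀ 1 a.big F

/-- `F` is the asymptotic Arnold multiplicity of `a`, on its big cone. -/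
def IsAsymptoticArn (a : GradedSystem ρ (AffRing d)) (F : (Fin ρ → ℝ) → ℝ) : Prop :=
  a.IsAsymptotic arn 1 a.big F

/-- `F` is the asymptotic Samuel multiplicity of `a` at the origin, on the region `D`. It requires
that for every integral vector `v` in the cone over `D` the ideals `𝔞_{nv}`, `n ≫ 0`, be supported
exactly at the origin. -/
def IsAsymptoticMult (a : GradedSystem ρ (AffRing d)) (D : Set (Fin ρ → ℝ))
    (F : (Fin ρ → ℝ) → ℝ) : Prop :=
  (∀ (v : Fin ρ → ℤ) (q : ℕ), 0 < q → (fun i => (v i : ℝ) / q) ∈ D →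
    ∀ᶠ n : ℕ in atTop, (a.ideal (n • v)).radical = originIdeal d) ∧
  a.IsAsymptotic samuelMult₀ d D F

end GradedSystem

/-- `F` is `C^∞` on no nonempty open subset of `D`. -/
def NowhereSmoothOn {n : ℕ} (F : (Fin n → ℝ) → ℝ) (D : Set (Fin n → ℝ)) : Prop :=
  ∀ W : Set (Fin n → ℝ), IsOpen W → W.Nonempty → W ⊆ D →
    ¬ ContDiffOn ℝ ((⊤ : ℕ∞) : WithTop ℕ∞) F W

/-- `f : ℝ^n → ℝ` is nonnegative, convex and positively homogeneous, that is, its epigraph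
`y ≥ f(x)` is a convex cone with vertex at the origin, contained in `y ≥ 0`. -/
structure IsConeFunction {n : ℕ} (f : (Fin n → ℝ) → ℝ) : Prop where
  nonneg : ∀ x, 0 ≤ f x
  convex : ConvexOn ℝ univ f
  homogeneous : ∀ (t : ℝ) (x : Fin n → ℝ), 0 ≤ t → f (t • x) = t * f x

/-- The epigraph `{(x_1, …, x_n, y) | y ≥ f(x_1, …, x_n)}` in `ℝ^{n+1}`. -/
def epiCone {n : ℕ} (f : (Fin n → ℝ) → ℝ) : Set (Fin (n + 1) → ℝ) :=
  {p | f (Fin.init p) ≤ p (Fin.last n)}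

/-- `a` is the `ℤ^{n+1}`-graded system `𝔪_•^C` on `ℂ^d` attached to the cone `C : y ≥ f(x)`:
`𝔞_{(x, y)} = (z_1, …, z_d) ^ ⌈f(x) - y⌉`, a power with negative exponent being the unit ideal. -/
def IsConeSystem {n d : ℕ} (f : (Fin n → ℝ) → ℝ) (a : GradedSystem (n + 1) (AffRing d)) : Prop :=
  ∀ v : Fin (n + 1) → ℤ, a.ideal v =
    originIdeal d ^ (⌈f (fun i => (Fin.init v i : ℝ)) - (v (Fin.last n) : ℝ)⌉).toNat

end

/-!
The plane carries the convex, positively homogeneous function `∑ q, c_q |x₀ - q x₁|`, summed over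
all rational slopes with summable positive weights. Every term has nonnegative second differences,
so the kink of the term `q` along `x₀ = q x₁` cannot be cancelled by the others, and these lines are
dense (`not_differentiableOn_kinkFun`).

For a cone function `f`, the map `(x, y) ↦ f x - y` is subadditive, which makes the powers
`𝔪 ^ ⌈f x - y⌉` a graded system. The ideal of index `v` is never zero, and is the unit ideal exactly
when `v` lies in the epigraph; since the integral vectors of an open cone span it up to closure
(`subset_closedConeSpan`), the big cone is everything and the nef cone is the epigraph.

The invariants of the system reduce to those of the powers of `𝔪`.
* The order of `𝔪 ^ k` at the origin is `k`, as symbolic and ordinary powers of the maximal ideal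
  `𝔪` agree.
* The log-canonical threshold of `𝔪 ^ k` is `d / k` (`lct_originIdeal_pow`): up to constants,
  `∑ |g| ^ 2` over any finite set of generators is `‖z‖ ^ (2 * k)` near the origin, and
  `‖z‖ ^ (-2kc)` is integrable at the origin of `ℝ ^ (2 * d)` if and only if `k * c < d`.
* The multiplicity of `𝔪 ^ k` is `k ^ d` (`samuelMult₀_originIdeal_pow`): the length of
  `𝒪 ⧸ 𝔪 ^ N` is the number `(N + d - 1).choose d` of monomials of degree less than `N`.

So each invariant has the form `c k ^ e` on `𝔪 ^ k`, and `⌈n s⌉ / n → s` gives `c (f x - y) ^ e` in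
the limit. If this were smooth on an open set where `f x - y > 0`, then so would be its `e`-th root,
hence `f` on an open slice.
-/

noncomputable section

/-! ### A convex cone function on the plane with a dense set of kinks -/

/-- Weights indexed by the slopes `q`, decaying fast enough for
`∑ q, kinkWeight q * |x₀ - q x₁|` to converge everywhere. -/
def kinkWeight (q : ℚ) : ℝ := (1 / 2) ^ Encodable.encode q / (1 + |(q : ℝ)|)

/-- The function `x ↦ ∑ q, kinkWeight q * |x₀ - q x₁|` on the plane, the sum being over all rational
slopes; it has a kink along each line `x₀ = q x₁`. -/
def kinkFun (x : Fin 2 → ℝ) : ℝ := ∑' q : ℚ, kinkWeight q * |x 0 - q * x 1|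

theorem kinkWeight_pos (q : ℚ) : 0 < kinkWeight q := by
  unfold kinkWeight; positivity

theorem summable_kinkFun (x : Fin 2 → ℝ) :
    Summable fun q : ℚ => kinkWeight q * |x 0 - q * x 1| := by
  refine Summable.of_nonneg_of_le (fun q => by have := kinkWeight_pos q; positivity) (fun q => ?_)
    ((summable_geometric_two_encode (ι := ℚ)).mul_right (|x 0| + |x 1|))
  have h : |x 0 - q * x 1| ≤ (1 + |(q : ℝ)|) * (|x 0| + |x 1|) := by
    have h1 := abs_sub (x 0) (q * x 1)
    rw [abs_mul] at h1
    nlinarith [abs_nonneg (x 0), abs_nonneg (x 1), abs_nonneg (q : ℝ),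
      mul_nonneg (abs_nonneg (q : ℝ)) (abs_nonneg (x 0))]
  have hq : 0 < 1 + |(q : ℝ)| := by positivity
  rw [kinkWeight, div_mul_eq_mul_div, div_le_iff₀ hq, mul_assoc]
  refine mul_le_mul_of_nonneg_left ?_ (by positivity)
  linarith

theorem isConeFunction_kinkFun : IsConeFunction kinkFun where
  nonneg x := tsum_nonneg fun q => mul_nonneg (kinkWeight_pos q).le (abs_nonneg _)
  convex := by
    refine ⟨convex_univ, fun x _ y _ s t hs ht _ => ?_⟩
    simp only [kinkFun, smul_eq_mul]
    rw [← tsum_mul_left, ← tsum_mul_left,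
      ← ((summable_kinkFun x).mul_left s).tsum_add ((summable_kinkFun y).mul_left t)]
    refine (summable_kinkFun _).tsum_le_tsum (fun q => ?_)
      (((summable_kinkFun x).mul_left s).add ((summable_kinkFun y).mul_left t))
    have h := abs_add_le (s * (x 0 - q * x 1)) (t * (y 0 - q * y 1))
    rw [abs_mul, abs_mul, abs_of_nonneg hs, abs_of_nonneg ht] at h
    have e : (s • x + t • y) 0 - q * (s • x + t • y) 1
        = s * (x 0 - q * x 1) + t * (y 0 - q * y 1) := by
      simp only [Pi.add_apply, Pi.smul_apply, smul_eq_mul]; ring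
    rw [e]
    nlinarith [mul_le_mul_of_nonneg_left h (kinkWeight_pos q).le]
  homogeneous t x ht := by
    simp only [kinkFun, Pi.smul_apply, smul_eq_mul]
    rw [← tsum_mul_left]
    refine tsum_congr fun q => ?_
    rw [show t * x 0 - q * (t * x 1) = t * (x 0 - q * x 1) by ring, abs_mul, abs_of_nonneg ht]
    ring

/-- Each term of `kinkFun` has nonnegative second differences, and the term of slope `q` contributes
`2 * kinkWeight q * |t|` on its own line of kinks. -/
theorem le_secondDiff_kinkFun (q : ℚ) (x : Fin 2 → ℝ) (hx : x 0 = q * x 1) (t : ℝ) :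
    2 * kinkWeight q * |t| ≤
      kinkFun (x + t • Pi.single 0 1) + kinkFun (x + (-t) • Pi.single 0 1) - 2 * kinkFun x := by
  have s1 := summable_kinkFun (x + t • Pi.single 0 1)
  have s2 := summable_kinkFun (x + (-t) • Pi.single 0 1)
  have s3 := (summable_kinkFun x).mul_left 2
  simp only [kinkFun]
  rw [← tsum_mul_left, ← s1.tsum_add s2, ← (s1.add s2).tsum_sub s3]
  refine le_trans (le_of_eq ?_) (((s1.add s2).sub s3).le_tsum q fun r _ => ?_)
  · simp [hx]; ring
  · have h := abs_add_le (x 0 + t - r * x 1) (x 0 + -t - r * x 1)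
    rw [show x 0 + t - r * x 1 + (x 0 + -t - r * x 1) = 2 * (x 0 - r * x 1) by ring, abs_mul,
      abs_two] at h
    simp only [Pi.add_apply, Pi.smul_apply, Pi.single_eq_same, smul_eq_mul, mul_one, ne_eq,
      one_ne_zero, not_false_eq_true, Pi.single_eq_of_ne, mul_zero, add_zero]
    nlinarith [mul_le_mul_of_nonneg_left h (kinkWeight_pos r).le]

theorem not_differentiableAt_kinkFun (q : ℚ) (x : Fin 2 → ℝ) (hx : x 0 = q * x 1) :
    ¬ DifferentiableAt ℝ kinkFun x := by
  intro hd
  have hline : ∀ s : ℝ, HasDerivAt (fun t : ℝ => x + (s * t) • (Pi.single 0 1 : Fin 2 → ℝ))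
      (s • Pi.single 0 1) 0 := fun s => by
    simpa using (((hasDerivAt_id (0 : ℝ)).const_mul s).smul_const
      (Pi.single 0 1 : Fin 2 → ℝ)).const_add x
  have hcomp : ∀ s : ℝ, HasDerivAt (fun t : ℝ => kinkFun (x + (s * t) • Pi.single 0 1))
      (fderiv ℝ kinkFun x (s • Pi.single 0 1)) 0 := fun s => by
    refine HasFDerivAt.comp_hasDerivAt (0 : ℝ) (l := kinkFun) ?_ (hline s)
    simpa using hd.hasFDerivAt
  -- Were `kinkFun` differentiable, the second difference minus `2 * kinkWeight q * t` would have a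
  -- minimum at `t = 0` and nonzero slope there.
  let g : ℝ → ℝ := fun t => kinkFun (x + (1 * t) • Pi.single 0 1) +
    kinkFun (x + (-1 * t) • Pi.single 0 1) - 2 * kinkFun x - 2 * kinkWeight q * t
  have hg : HasDerivAt g _ 0 := (((hcomp 1).add (hcomp (-1))).sub_const (2 * kinkFun x)).sub
    ((hasDerivAt_id (0 : ℝ)).const_mul (2 * kinkWeight q))
  have hmin : IsLocalMin g 0 := by
    refine Filter.Eventually.of_forall fun t => ?_
    have h0 : g 0 = 0 := by simp [g]; ring
    have h1 := le_secondDiff_kinkFun q x hx t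
    have h2 : 2 * kinkWeight q * t ≤ 2 * kinkWeight q * |t| :=
      mul_le_mul_of_nonneg_left (le_abs_self t) (by linarith [kinkWeight_pos q])
    rw [h0]
    simp only [g, one_mul, neg_one_mul]
    linarith
  have h0 := hmin.hasDerivAt_eq_zero hg
  have hpos := kinkWeight_pos q
  rw [map_smul, map_smul, smul_eq_mul, smul_eq_mul] at h0
  linarith

theorem not_differentiableOn_kinkFun (W : Set (Fin 2 → ℝ)) (hW : IsOpen W) (hne : W.Nonempty) :
    ¬ DifferentiableOn ℝ kinkFun W := by
  obtain ⟨x, hx⟩ := hne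
  -- Move off the line `x₁ = 0`, then move `x₀` to make the ratio `x₀ / x₁` rational.
  obtain ⟨b, hbW, hb⟩ : ∃ b : ℝ, ![x 0, b] ∈ W ∧ b ≠ 0 := by
    have ho : IsOpen {b : ℝ | ![x 0, b] ∈ W} := hW.preimage (by fun_prop)
    obtain ⟨b, hb, hb0⟩ := (dense_compl_singleton (0 : ℝ)).inter_open_nonempty _ ho
      ⟨x 1, by simpa [show ![x 0, x 1] = x by ext i; fin_cases i <;> rfl] using hx⟩
    exact ⟨b, hb, hb0⟩
  obtain ⟨q, hq⟩ := (Rat.denseRange_cast (𝕜 := ℝ)).exists_mem_open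
    (show IsOpen {r : ℝ | ![r * b, b] ∈ W} from hW.preimage (by fun_prop))
    ⟨x 0 / b, by simpa [div_mul_cancel₀ _ hb] using hbW⟩
  exact fun h => not_differentiableAt_kinkFun q _ (by simp) (h.differentiableAt (hW.mem_nhds hq))

/-! ### Powers of the ideal of the origin -/

theorem mem_originIdeal_pow {d n : ℕ} {p : AffRing d} :
    p ∈ originIdeal d ^ n ↔ ∀ x, Finsupp.degree x < n → p.coeff x = 0 :=
  MvPolynomial.mem_pow_idealOfVars_iff' n p

theorem originIdeal_pow_le_pow_iff {d : ℕ} (hd : 1 ≤ d) {j n : ℕ} :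
    originIdeal d ^ j ≤ originIdeal d ^ n ↔ n ≤ j := by
  refine ⟨fun h => ?_, Ideal.pow_le_pow_right⟩
  have h1 : MvPolynomial.monomial (Finsupp.single (⟨0, hd⟩ : Fin d) j) (1 : ℂ)
      ∈ originIdeal d ^ n :=
    h ((MvPolynomial.monomial_mem_pow_idealOfVars_iff j _ one_ne_zero).2 (by simp))
  simpa using (MvPolynomial.monomial_mem_pow_idealOfVars_iff n _ one_ne_zero).1 h1

theorem originIdeal_pow_eq_top_iff {d : ℕ} (hd : 1 ≤ d) {k : ℕ} :
    originIdeal d ^ k = ⊤ ↔ k = 0 := by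
  rw [← top_le_iff, ← Nat.le_zero, ← originIdeal_pow_le_pow_iff hd, pow_zero, Ideal.one_eq_top]

theorem originIdeal_pow_ne_bot {d : ℕ} (hd : 1 ≤ d) (k : ℕ) : originIdeal d ^ k ≠ ⊥ := fun h => by
  have := (originIdeal_pow_le_pow_iff hd (j := k) (n := k + 1)).1 (h ▸ bot_le)
  omega

instance originIdeal_isMaximal (d : ℕ) : (originIdeal d).IsMaximal := by
  rw [originIdeal_eq_ker]
  exact RingHom.ker_isMaximal_of_surjective _ fun c => ⟨MvPolynomial.C c, by simp⟩

theorem symbolicPower_originIdeal (d n : ℕ) :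
    symbolicPower (originIdeal d) n = originIdeal d ^ n := by
  rw [symbolicPower, Localization.AtPrime.map_eq_maximalIdeal]
  exact IsLocalization.AtPrime.under_maximalIdeal_pow (originIdeal d) _ n

theorem ord₀_originIdeal_pow {d : ℕ} (hd : 1 ≤ d) (k : ℕ) : ord₀ (originIdeal d ^ k) = k := by
  simp only [ord₀, ordAlong, symbolicPower_originIdeal, originIdeal_pow_le_pow_iff hd]
  refine le_antisymm (iSup₂_le fun n hn => by exact_mod_cast hn) (le_iSup₂_of_le k le_rfl le_rfl)

theorem radical_originIdeal_pow (d : ℕ) {k : ℕ} (hk : k ≠ 0) :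
    (originIdeal d ^ k).radical = originIdeal d := by
  rw [Ideal.radical_pow _ hk, (originIdeal_isPrime d).radical]

/-! ### The log-canonical threshold of a power of the ideal of the origin -/

/-- On a ball, a member of the ideal generated by `S` is bounded by the generators. -/
theorem exists_enorm_sq_le_of_mem_span {d : ℕ} {S : Finset (AffRing d)} {f : AffRing d}
    (hf : f ∈ Ideal.span (S : Set (AffRing d))) (r : ℝ) :
    ∃ M : ℝ≥0∞, M ≠ ∞ ∧ ∀ z ∈ Metric.ball (0 : Fin d → ℂ) r,
      ‖MvPolynomial.eval z f‖ₑ ^ 2 ≤ M * ∑ g ∈ S, ‖MvPolynomial.eval z g‖ₑ ^ 2 := by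
  induction hf using Submodule.span_induction with
  | mem g hg =>
    refine ⟨1, ENNReal.one_ne_top, fun z _ => ?_⟩
    rw [one_mul]
    exact Finset.single_le_sum (f := fun g => ‖MvPolynomial.eval z g‖ₑ ^ 2)
      (fun _ _ => zero_le) hg
  | zero => exact ⟨0, ENNReal.zero_ne_top, fun z _ => by simp⟩
  | add f g _ _ hf hg =>
    obtain ⟨M, hM, hf⟩ := hf
    obtain ⟨N, hN, hg⟩ := hg
    refine ⟨2 * (M + N), by finiteness, fun z hz => ?_⟩
    rw [map_add]
    calc ‖MvPolynomial.eval z f + MvPolynomial.eval z g‖ₑ ^ 2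
        ≤ (‖MvPolynomial.eval z f‖ₑ + ‖MvPolynomial.eval z g‖ₑ) ^ 2 := by
          gcongr; exact enorm_add_le _ _
      _ ≤ 2 * (‖MvPolynomial.eval z f‖ₑ ^ 2 + ‖MvPolynomial.eval z g‖ₑ ^ 2) := by
          simp only [enorm_eq_nnnorm]
          have h := add_sq_le (a := ‖MvPolynomial.eval z f‖₊) (b := ‖MvPolynomial.eval z g‖₊)
          exact_mod_cast h
      _ ≤ 2 * (M + N) * ∑ g ∈ S, ‖MvPolynomial.eval z g‖ₑ ^ 2 := by
          rw [mul_assoc, add_mul]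
          gcongr
          exacts [hf z hz, hg z hz]
  | smul a f _ hf =>
    obtain ⟨M, hM, hf⟩ := hf
    obtain ⟨B, hB⟩ := (ProperSpace.isCompact_closedBall
      (0 : Fin d → ℂ) r).exists_bound_of_continuousOn (f := fun z => MvPolynomial.eval z a)
      (MvPolynomial.continuous_eval a).continuousOn
    refine ⟨ENNReal.ofReal B ^ 2 * M, by finiteness, fun z hz => ?_⟩
    rw [smul_eq_mul, map_mul, enorm_mul, mul_pow, mul_assoc]
    gcongr
    · rw [← ofReal_norm]
      exact ENNReal.ofReal_le_ofReal (hB z (Metric.ball_subset_closedBall hz))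
    · exact hf z hz

/-- Generators of the unit ideal have no common zero, so that the weight is locally bounded. -/
theorem multiplierIdeal_top (d : ℕ) {c : ℝ} (hc : 0 < c) :
    multiplierIdeal c (⊤ : Ideal (AffRing d)) = ⊤ := by
  rw [Ideal.eq_top_iff_one]
  intro S hS x
  obtain ⟨M, hM, hb⟩ := exists_enorm_sq_le_of_mem_span
    (hS ▸ Submodule.mem_top : (1 : AffRing d) ∈ Ideal.span (S : Set (AffRing d))) (‖x‖ + 1)
  refine ⟨Metric.ball 0 (‖x‖ + 1), Metric.isOpen_ball.mem_nhds (by simp), ?_⟩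
  calc ∫⁻ z in Metric.ball 0 (‖x‖ + 1), multiplierWeight c S 1 z
      ≤ ∫⁻ _ in Metric.ball (0 : Fin d → ℂ) (‖x‖ + 1), M ^ c := by
        refine setLIntegral_mono' measurableSet_ball fun z hz => ?_
        have h := hb z hz
        simp only [map_one, enorm_one, one_pow] at h
        simp only [multiplierWeight, map_one, enorm_one, one_pow]
        refine ENNReal.div_le_of_le_mul ?_
        rw [← ENNReal.mul_rpow_of_nonneg _ _ hc.le]
        exact ENNReal.one_le_rpow h hc
    _ < ∞ := by
        rw [setLIntegral_const]
        exact ENNReal.mul_lt_top (ENNReal.rpow_lt_top_of_nonneg hc.le hM) measure_ball_lt_top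

theorem finrank_real_pi_complex (d : ℕ) : Module.finrank ℝ (Fin d → ℂ) = 2 * d := by
  simp [Module.finrank_pi_fintype, mul_comm]

/-- The powers of the coordinates bound `‖z‖ ^ (2 * k)`, for the sup norm, by the generators. -/
theorem exists_enorm_pow_le {d k : ℕ} {S : Finset (AffRing d)}
    (hS : Ideal.span (S : Set (AffRing d)) = originIdeal d ^ k) (hd : 1 ≤ d) (r : ℝ) :
    ∃ M : ℝ≥0∞, M ≠ ∞ ∧ ∀ z ∈ Metric.ball (0 : Fin d → ℂ) r,
      ‖z‖ₑ ^ (2 * k) ≤ M * ∑ g ∈ S, ‖MvPolynomial.eval z g‖ₑ ^ 2 := by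
  have hX : ∀ i : Fin d, (MvPolynomial.X i : AffRing d) ^ k ∈ Ideal.span (S : Set (AffRing d)) :=
    fun i => hS ▸ Ideal.pow_mem_pow (Ideal.subset_span (mem_range_self i)) k
  choose M hM hb using fun i => exists_enorm_sq_le_of_mem_span (hX i) r
  refine ⟨∑ i, M i, ENNReal.sum_ne_top.2 fun i _ => hM i, fun z hz => ?_⟩
  have : Nonempty (Fin d) := ⟨⟨0, hd⟩⟩
  obtain ⟨i, hi⟩ := Finite.exists_max fun i => ‖z i‖
  have hzi : ‖z‖ₑ ≤ ‖z i‖ₑ :=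
    enorm_le_iff_norm_le.2 ((pi_norm_le_iff_of_nonneg (norm_nonneg _)).2 hi)
  calc ‖z‖ₑ ^ (2 * k) ≤ ‖MvPolynomial.eval z (MvPolynomial.X i ^ k)‖ₑ ^ 2 := by
        rw [map_pow, MvPolynomial.eval_X, enorm_pow, ← pow_mul, mul_comm k]
        gcongr
    _ ≤ M i * ∑ g ∈ S, ‖MvPolynomial.eval z g‖ₑ ^ 2 := hb i z hz
    _ ≤ (∑ i, M i) * ∑ g ∈ S, ‖MvPolynomial.eval z g‖ₑ ^ 2 := by
        gcongr
        exact Finset.single_le_sum (fun _ _ => zero_le) (Finset.mem_univ i)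

theorem enorm_rpow_neg {d : ℕ} {z : Fin d → ℂ} (hz : z ≠ 0) (c : ℝ) (k : ℕ) :
    ‖(‖z‖ ^ (-(2 * k * c)) : ℝ)‖ₑ = ((‖z‖ₑ ^ (2 * k)) ^ c)⁻¹ := by
  have hz' : 0 < ‖z‖ := norm_pos_iff.2 hz
  rw [Real.enorm_of_nonneg (by positivity), ← ENNReal.ofReal_rpow_of_pos hz',
    ofReal_norm, ENNReal.rpow_neg, ← ENNReal.rpow_natCast, ← ENNReal.rpow_mul]
  push_cast
  rfl

theorem ae_ne_zero_of_one_le {d : ℕ} (hd : 1 ≤ d) : ∀ᵐ z : Fin d → ℂ, z ≠ 0 := by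
  have : Nonempty (Fin d) := ⟨⟨0, hd⟩⟩
  exact Measure.ae_ne volume 0

/-- The weight is `O(‖z‖ ^ (-2kc))`, which is locally integrable in real dimension `2d > 2kc`. -/
theorem multiplierIdeal_originIdeal_pow_eq_top {d k : ℕ} (hd : 1 ≤ d) {c : ℝ} (hc : 0 < c)
    (hck : k * c < d) : multiplierIdeal c (originIdeal d ^ k) = ⊤ := by
  rw [Ideal.eq_top_iff_one]
  intro S hS x
  obtain ⟨M, hM, hb⟩ := exists_enorm_pow_le hS hd (‖x‖ + 1)
  refine ⟨Metric.ball 0 (‖x‖ + 1), Metric.isOpen_ball.mem_nhds (by simp), ?_⟩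
  have hint : IntegrableOn (fun z : Fin d → ℂ => ‖z‖ ^ (-(2 * k * c)))
      (Metric.ball 0 (‖x‖ + 1)) := by
    refine integrableOn_ball_of_norm_le_rpow (C := 1) (α := 2 * k * c) ?_ ?_ ?_ ?_
    · rw [finrank_real_pi_complex]; omega
    · rw [finrank_real_pi_complex]; push_cast; linarith
    · refine Eventually.of_forall fun z => ?_
      rw [Real.norm_of_nonneg (by positivity), one_mul]
    · exact (measurable_norm.pow_const _).aestronglyMeasurable
  calc ∫⁻ z in Metric.ball 0 (‖x‖ + 1), multiplierWeight c S 1 z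
      ≤ ∫⁻ z in Metric.ball (0 : Fin d → ℂ) (‖x‖ + 1), M ^ c * ‖(‖z‖ ^ (-(2 * k * c)) : ℝ)‖ₑ := by
        refine setLIntegral_mono_ae' measurableSet_ball ?_
        filter_upwards [ae_ne_zero_of_one_le hd] with z hz0 hz
        rw [enorm_rpow_neg hz0]
        simp only [multiplierWeight, map_one, enorm_one, one_pow]
        have hz1 : (‖z‖ₑ ^ (2 * k)) ^ c ≠ 0 := by simp [hz0]
        have hz2 : (‖z‖ₑ ^ (2 * k)) ^ c ≠ ∞ := by finiteness
        refine ENNReal.div_le_of_le_mul ?_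
        rw [mul_right_comm, ← ENNReal.mul_rpow_of_nonneg _ _ hc.le, ← div_eq_mul_inv,
          ENNReal.le_div_iff_mul_le (Or.inl hz1) (Or.inl hz2), one_mul]
        exact ENNReal.rpow_le_rpow (hb z hz) hc.le
    _ = M ^ c * ∫⁻ z in Metric.ball (0 : Fin d → ℂ) (‖x‖ + 1), ‖(‖z‖ ^ (-(2 * k * c)) : ℝ)‖ₑ :=
        lintegral_const_mul _ (measurable_norm.pow_const _).enorm
    _ < ∞ := ENNReal.mul_lt_top (ENNReal.rpow_lt_top_of_nonneg hc.le hM) hint.hasFiniteIntegral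

/-- A polynomial of order at least `k` at the origin is `O(‖z‖ ^ k)` there. -/
theorem exists_enorm_eval_le {d k : ℕ} {g : AffRing d} (hg : g ∈ originIdeal d ^ k) :
    ∃ M : ℝ≥0∞, M ≠ ∞ ∧ ∀ z ∈ Metric.ball (0 : Fin d → ℂ) 1,
      ‖MvPolynomial.eval z g‖ₑ ≤ M * ‖z‖ₑ ^ k := by
  refine ⟨∑ x ∈ g.support, ‖g.coeff x‖ₑ, ENNReal.sum_ne_top.2 fun _ _ => enorm_ne_top,
    fun z hz => ?_⟩
  have hz1 : ‖z‖ₑ ≤ 1 := by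
    rw [← ofReal_norm]
    exact ENNReal.ofReal_le_one.2 (mem_ball_zero_iff.1 hz).le
  have hzi : ∀ i, ‖z i‖ₑ ≤ ‖z‖ₑ := fun i => by
    rw [← ofReal_norm, ← ofReal_norm]
    exact ENNReal.ofReal_le_ofReal (norm_le_pi_norm z i)
  rw [MvPolynomial.eval_eq', Finset.sum_mul]
  refine (enorm_sum_le _ _).trans (Finset.sum_le_sum fun x hx => ?_)
  rw [enorm_mul]
  gcongr
  have hk : k ≤ Finsupp.degree x := (MvPolynomial.mem_pow_idealOfVars_iff k g).1 hg x hx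
  calc ‖∏ i, z i ^ x i‖ₑ = ∏ i, ‖z i‖ₑ ^ x i := by
        simp only [enorm_eq_nnnorm, nnnorm_prod, nnnorm_pow]; push_cast; rfl
    _ ≤ ∏ i, ‖z‖ₑ ^ x i := Finset.prod_le_prod' fun i _ => pow_le_pow_left' (hzi i) _
    _ = ‖z‖ₑ ^ Finsupp.degree x := by rw [Finset.prod_pow_eq_pow_sum, Finsupp.degree_eq_sum]
    _ ≤ ‖z‖ₑ ^ k := pow_le_pow_right_of_le_one' hz1 hk

/-- Near the origin the weight is bounded below by a multiple of `‖z‖ ^ (-2kc)`, which is not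
integrable there when `2kc ≥ 2d`. -/
theorem multiplierIdeal_originIdeal_pow_ne_top {d k : ℕ} (hd : 1 ≤ d) {c : ℝ} (hc : 0 < c)
    (hck : d ≤ k * c) : multiplierIdeal c (originIdeal d ^ k) ≠ ⊤ := by
  intro htop
  have hone : (1 : AffRing d) ∈ multiplierIdeal c (originIdeal d ^ k) := htop ▸ Submodule.mem_top
  obtain ⟨S, hS⟩ : (originIdeal d ^ k).FG := IsNoetherian.noetherian _
  obtain ⟨U, hU, hfin⟩ := hone S hS 0
  have hmem : ∀ g : S, g.1 ∈ originIdeal d ^ k := fun g => hS ▸ Ideal.subset_span g.2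
  choose M hM hb using fun g : S => exists_enorm_eval_le (hmem g)
  obtain ⟨N, hN, hN0, hbN⟩ : ∃ N : ℝ≥0∞, N ≠ ∞ ∧ N ≠ 0 ∧
      ∀ z ∈ Metric.ball (0 : Fin d → ℂ) 1,
        ∑ g ∈ S, ‖MvPolynomial.eval z g‖ₑ ^ 2 ≤ N * ‖z‖ₑ ^ (2 * k) := by
    have hfin : ∑ g : S, M g ^ 2 ≠ ∞ := ENNReal.sum_ne_top.2 fun g _ => ENNReal.pow_ne_top (hM g)
    -- The summand `1` only makes the constant nonzero, so that it can be divided by.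
    refine ⟨∑ g : S, M g ^ 2 + 1, by finiteness, by simp, fun z hz => ?_⟩
    refine le_trans ?_ (mul_le_mul_left (self_le_add_right _ _) _)
    rw [← Finset.sum_coe_sort, Finset.sum_mul]
    refine Finset.sum_le_sum fun g _ => ?_
    rw [mul_comm 2 k, pow_mul, ← mul_pow]
    exact pow_le_pow_left' (hb g z hz) 2
  obtain ⟨r, hr, hrU⟩ := Metric.mem_nhds_iff.1 hU
  set s := min r 1 with hs
  have hs0 : 0 < s := lt_min hr one_pos
  have hlt : ∫⁻ z in Metric.ball (0 : Fin d → ℂ) s, ‖(‖z‖ ^ (-(2 * k * c)) : ℝ)‖ₑ < ∞ := by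
    calc ∫⁻ z in Metric.ball (0 : Fin d → ℂ) s, ‖(‖z‖ ^ (-(2 * k * c)) : ℝ)‖ₑ
        ≤ ∫⁻ z in Metric.ball (0 : Fin d → ℂ) s, N ^ c * multiplierWeight c S 1 z := by
          refine setLIntegral_mono_ae' measurableSet_ball ?_
          filter_upwards [ae_ne_zero_of_one_le hd] with z hz0 hz
          rw [enorm_rpow_neg hz0]
          simp only [multiplierWeight, map_one, enorm_one, one_pow]
          have hle := ENNReal.rpow_le_rpow
            (hbN z (Metric.ball_subset_ball (min_le_right _ _) hz)) hc.le
          rw [ENNReal.mul_rpow_of_nonneg _ _ hc.le] at hle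
          have hz1 : (‖z‖ₑ ^ (2 * k)) ^ c ≠ 0 := by simp [hz0]
          have hz2 : (‖z‖ₑ ^ (2 * k)) ^ c ≠ ∞ := by finiteness
          have hNc : N ^ c ≠ ∞ := (ENNReal.rpow_lt_top_of_nonneg hc.le hN).ne
          have hNc0 : N ^ c ≠ 0 := by simp [hN0, hN]
          rw [one_div, ← div_eq_mul_inv, ENNReal.le_div_iff_mul_le (Or.inr hNc0) (Or.inr hNc)]
          calc _ ≤ ((‖z‖ₑ ^ (2 * k)) ^ c)⁻¹ * (N ^ c * (‖z‖ₑ ^ (2 * k)) ^ c) := by gcongr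
            _ = N ^ c := by rw [mul_left_comm, ENNReal.inv_mul_cancel hz1 hz2, mul_one]
      _ = N ^ c * ∫⁻ z in Metric.ball (0 : Fin d → ℂ) s, multiplierWeight c S 1 z :=
          lintegral_const_mul _ (measurable_multiplierWeight c S 1)
      _ ≤ N ^ c * ∫⁻ z in U, multiplierWeight c S 1 z := by
          gcongr
          exact (Metric.ball_subset_ball (min_le_left _ _)).trans hrU
      _ < ∞ := ENNReal.mul_lt_top (ENNReal.rpow_lt_top_of_nonneg hc.le hN) hfin
  have hint : IntegrableOn (fun z : Fin d → ℂ => ‖z‖ ^ (-(2 * k * c))) (Metric.ball 0 s) :=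
    ⟨(measurable_norm.pow_const _).aestronglyMeasurable, hlt⟩
  have : Nonempty (Fin d) := ⟨⟨0, hd⟩⟩
  have h1 := (integrableOn_fun_norm_addHaar volume (f := fun y : ℝ => y ^ (-(2 * k * c)))).1 hint
  have h2 : IntegrableOn (fun y : ℝ => y ^ ((2 * d - 1 : ℝ) - 2 * k * c)) (Ioo 0 s) := by
    refine h1.congr_fun (fun y hy => ?_) measurableSet_Ioo
    simp only [finrank_real_pi_complex, smul_eq_mul]
    rw [← Real.rpow_natCast, ← Real.rpow_add hy.1, Nat.cast_sub (by omega)]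
    push_cast
    ring_nf
  rw [intervalIntegral.integrableOn_Ioo_rpow_iff hs0] at h2
  linarith

theorem lct_originIdeal_pow {d k : ℕ} (hd : 1 ≤ d) (hk : 1 ≤ k) :
    lct (originIdeal d ^ k) = ENNReal.ofReal (d / k) := by
  have hk' : (0 : ℝ) < k := by exact_mod_cast hk
  have hd' : (0 : ℝ) < d := by exact_mod_cast hd
  have hne : multiplierIdeal (d / k : ℝ) (originIdeal d ^ k) ≠ ⊤ :=
    multiplierIdeal_originIdeal_pow_ne_top hd (by positivity) (mul_div_cancel₀ _ hk'.ne').ge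
  refine le_antisymm (iInf₂_le (d / k : ℝ) ⟨by positivity, hne⟩) (le_iInf₂ fun c hc => ?_)
  · refine ENNReal.ofReal_le_ofReal ?_
    by_contra! h
    refine hc.2 (multiplierIdeal_originIdeal_pow_eq_top hd hc.1 ?_)
    rwa [lt_div_iff₀ hk', mul_comm] at h

theorem arn_originIdeal_pow {d : ℕ} (hd : 1 ≤ d) (k : ℕ) :
    arn (originIdeal d ^ k) = (k : ℝ≥0∞) / d := by
  rcases Nat.eq_zero_or_pos k with rfl | hk
  · have h : lct (⊤ : Ideal (AffRing d)) = ∞ :=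
      iInf₂_eq_top.2 fun c hc => absurd (multiplierIdeal_top d hc.1) hc.2
    simp [arn, Ideal.one_eq_top, h]
  · have hk' : (0 : ℝ) < k := by exact_mod_cast hk
    rw [arn, lct_originIdeal_pow hd hk, ENNReal.ofReal_div_of_pos hk', ENNReal.ofReal_natCast,
      ENNReal.ofReal_natCast, ENNReal.inv_div (Or.inl (by simp)) (Or.inl (by positivity))]

/-! ### The Samuel multiplicity of a power of the ideal of the origin -/

/-- Over a `K`-algebra all of whose elements are scalars up to a nilpotent, the simple modules are
one-dimensional over `K`, so that length and dimension agree. -/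
theorem Module.length_eq_of_forall_isNilpotent_sub {K A M : Type*} [Field K] [CommRing A]
    [Algebra K A] (hA : ∀ a : A, ∃ c : K, IsNilpotent (a - algebraMap K A c)) [AddCommGroup M]
    [Module A M] (hM : IsFiniteLength A M) :
    ∀ [Module K M] [IsScalarTower K A M], Module.length A M = Module.length K M := by
  induction hM with
  | of_subsingleton => intros; simp
  | @of_simple_quotient M _ _ N hsimple hN ih =>
    intro _ _
    have hq : Module.length A (M ⧸ N) = Module.length K (M ⧸ N) := by
      obtain ⟨I, hI, ⟨e⟩⟩ := isSimpleModule_iff_quot_maximal.1 hsimple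
      rw [e.length_eq, (e.restrictScalars K).length_eq,
        Module.length_eq_of_surjective (R := A ⧸ I) Ideal.Quotient.mk_surjective,
        Module.length_eq_of_surjective (R := A ⧸ I) (S := K)]
      intro y
      obtain ⟨a, rfl⟩ := Ideal.Quotient.mk_surjective y
      obtain ⟨c, m, hc⟩ := hA a
      refine ⟨c, (Ideal.Quotient.eq.2 ?_).symm⟩
      exact hI.isPrime.mem_of_pow_mem m (hc ▸ I.zero_mem)
    rw [Module.length_eq_add_of_exact N.subtype N.mkQ N.injective_subtype N.mkQ_surjective
        (LinearMap.exact_subtype_mkQ N), ih, hq,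
      Module.length_eq_add_of_exact (N.subtype.restrictScalars K) (N.mkQ.restrictScalars K)
        N.injective_subtype N.mkQ_surjective (LinearMap.exact_subtype_mkQ N)]

/-- The coefficients of a polynomial in degrees less than `N`. -/
def lowCoeff (d N : ℕ) : AffRing d →ₗ[ℂ] ({x : Fin d →₀ ℕ // Finsupp.degree x < N} → ℂ) :=
  LinearMap.pi fun x => MvPolynomial.lcoeff ℂ x.1

instance finite_degree_lt (d N : ℕ) : Finite {x : Fin d →₀ ℕ // Finsupp.degree x < N} :=
  ((Finsupp.finite_of_degree_le N).subset fun _ hx => mem_ofPred.2 (le_of_lt hx) :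
    {x : Fin d →₀ ℕ | Finsupp.degree x < N}.Finite).to_subtype

/-- The exponents of degree `i` are counted by multisets of size `i`; then sum over `i < N`. -/
theorem card_degree_lt (d N : ℕ) (hd : 1 ≤ d) :
    Nat.card {x : Fin d →₀ ℕ // Finsupp.degree x < N} = (N + d - 1).choose d := by
  classical
  have hset : {x : Fin d →₀ ℕ | Finsupp.degree x < N} =
      ((Finset.range N).biUnion fun i => (Finset.univ : Finset (Fin d)).finsuppAntidiag i) := by
    ext x
    simp [Finset.mem_finsuppAntidiag, Finsupp.degree_eq_sum]
  have hcard : Nat.card {x : Fin d →₀ ℕ // Finsupp.degree x < N} = _ :=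
    (congrArg Set.ncard hset).trans (Set.ncard_coe_finset _)
  rw [hcard, Finset.card_biUnion fun i _ j _ hij => ?_]
  · simp only [Finset.card_finsuppAntidiag_nat_eq_multichoose, Finset.card_univ, Fintype.card_fin]
    cases N with
    | zero => simp [Nat.choose_eq_zero_of_lt (show d - 1 < d by omega)]
    | succ N => rw [Nat.sum_range_multichoose, show N + 1 + d - 1 = N + d by omega]
  · refine Finset.disjoint_left.2 fun x hi hj => hij ?_
    rw [Finset.mem_finsuppAntidiag] at hi hj
    exact hi.1.symm.trans hj.1

theorem surjective_lowCoeff (d N : ℕ) : Function.Surjective (lowCoeff d N) := by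
  classical
  intro g
  have := Fintype.ofFinite {x : Fin d →₀ ℕ // Finsupp.degree x < N}
  refine ⟨∑ x, MvPolynomial.monomial x.1 (g x), ?_⟩
  ext y
  simp [lowCoeff, MvPolynomial.coeff_monomial, Subtype.val_inj]

theorem ker_lowCoeff (d N : ℕ) :
    LinearMap.ker (lowCoeff d N) = (originIdeal d ^ N).restrictScalars ℂ := by
  ext p
  simp [lowCoeff, mem_originIdeal_pow, funext_iff]

/-- `R ⧸ 𝔪 ^ N` as a vector space of truncated polynomials. -/
def quotOriginPowEquiv (d N : ℕ) : (AffRing d ⧸ originIdeal d ^ N) ≃ₗ[ℂ]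
    ({x : Fin d →₀ ℕ // Finsupp.degree x < N} → ℂ) :=
  (Submodule.Quotient.restrictScalarsEquiv ℂ (originIdeal d ^ N)).symm ≪≫ₗ
    Submodule.quotEquivOfEq _ _ (ker_lowCoeff d N).symm ≪≫ₗ
    (lowCoeff d N).quotKerEquivOfSurjective (surjective_lowCoeff d N)

theorem length_quot_originIdeal_pow (d N : ℕ) :
    Module.length (AffRing d ⧸ originIdeal d ^ N) (AffRing d ⧸ originIdeal d ^ N) =
      Nat.card {x : Fin d →₀ ℕ // Finsupp.degree x < N} := by
  have hfin : Module.Finite ℂ (AffRing d ⧸ originIdeal d ^ N) :=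
    Module.Finite.equiv (quotOriginPowEquiv d N).symm
  have := Fintype.ofFinite {x : Fin d →₀ ℕ // Finsupp.degree x < N}
  have hart : IsArtinianRing (AffRing d ⧸ originIdeal d ^ N) := IsArtinianRing.of_finite ℂ _
  rw [Module.length_eq_of_forall_isNilpotent_sub (K := ℂ) (fun a => ?_)
      (isFiniteLength_iff_isNoetherian_isArtinian.2 ⟨inferInstance, hart⟩),
    Module.length_eq_finrank, (quotOriginPowEquiv d N).finrank_eq,
    Module.finrank_fintype_fun_eq_card, Nat.card_eq_fintype_card]
  obtain ⟨p, rfl⟩ := Ideal.Quotient.mk_surjective a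
  refine ⟨MvPolynomial.constantCoeff p, N, ?_⟩
  change (Ideal.Quotient.mk _ p - Ideal.Quotient.mk _ (MvPolynomial.C _)) ^ N = 0
  rw [← map_sub, ← map_pow, Ideal.Quotient.eq_zero_iff_mem]
  refine Ideal.pow_mem_pow ?_ N
  rw [originIdeal_eq_ker, RingHom.mem_ker]
  simp

/-- Localizing at the origin does not change `R ⧸ 𝔪 ^ (k * n)`. -/
theorem length_localization_quot_originIdeal_pow (d k n : ℕ) :
    Module.length (Localization.AtPrime (originIdeal d)) (Localization.AtPrime (originIdeal d) ⧸
      ((originIdeal d ^ k).map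
        (algebraMap (AffRing d) (Localization.AtPrime (originIdeal d)))) ^ n) =
      Nat.card {x : Fin d →₀ ℕ // Finsupp.degree x < k * n} := by
  rw [Ideal.map_pow, Localization.AtPrime.map_eq_maximalIdeal, ← pow_mul,
    ← length_quot_originIdeal_pow]
  set A := Localization.AtPrime (originIdeal d)
  let e := IsLocalization.AtPrime.equivQuotMaximalIdealPow (originIdeal d) A (k * n)
  rw [← Module.length_eq_of_surjective (S := AffRing d) (R := AffRing d ⧸ _)
      Ideal.Quotient.mk_surjective, e.toLinearEquiv.length_eq,
    Module.length_eq_of_surjective (R := A ⧸ IsLocalRing.maximalIdeal A ^ (k * n)) (S := A)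
       Ideal.Quotient.mk_surjective,
    Module.length_eq_of_surjective (R := A ⧸ IsLocalRing.maximalIdeal A ^ (k * n)) (S := AffRing d)]
  intro y
  obtain ⟨x, rfl⟩ := e.surjective y
  obtain ⟨p, rfl⟩ := Ideal.Quotient.mk_surjective x
  exact ⟨p, rfl⟩

theorem tendsto_choose_div_pow (d k : ℕ) (hd : 1 ≤ d) :
    Tendsto (fun n : ℕ => (((k * n + d - 1).choose d : ℕ) : ℝ) / ((n : ℝ) ^ d / d.factorial)) atTop
      (𝓝 ((k : ℝ) ^ d)) := by
  rcases Nat.eq_zero_or_pos k with rfl | hk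
  · simp [Nat.choose_eq_zero_of_lt (show d - 1 < d by omega), show d ≠ 0 by omega]
  have hlin : Tendsto (fun n : ℕ => k * n + d - 1) atTop atTop :=
    tendsto_atTop_mono (fun n => show n ≤ _ by have := Nat.le_mul_of_pos_left n hk; omega)
      tendsto_id
  have hz : ∀ᶠ n : ℕ in atTop, (n : ℝ) ^ d / (d.factorial : ℝ) ≠ 0 := by
    filter_upwards [eventually_gt_atTop 0] with n hn
    positivity
  have h1 : Tendsto (fun m : ℕ => ((m.choose d : ℕ) : ℝ) / ((m : ℝ) ^ d / d.factorial)) atTop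
      (𝓝 1) := (Asymptotics.isEquivalent_iff_tendsto_one hz).1 (isEquivalent_choose d)
  have h2 : Tendsto (fun n : ℕ => ((k * n + d - 1 : ℕ) : ℝ) / n) atTop (𝓝 k) := by
    have h : Tendsto (fun n : ℕ => (k : ℝ) + ((d : ℝ) - 1) / n) atTop (𝓝 (k + 0)) :=
      tendsto_const_nhds.add (tendsto_const_div_atTop_nhds_zero_nat _)
    rw [add_zero] at h
    refine h.congr' ?_
    filter_upwards [eventually_gt_atTop 0] with n hn
    have hn' : (n : ℝ) ≠ 0 := by positivity
    rw [Nat.cast_sub (by omega)]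
    push_cast
    field_simp
    ring
  have h3 := (h1.comp hlin).mul (h2.pow d)
  rw [one_mul] at h3
  refine h3.congr' ?_
  filter_upwards [eventually_gt_atTop 0] with n hn
  have hm : (0 : ℝ) < ((k * n + d - 1 : ℕ) : ℝ) := by
    have := Nat.mul_pos hk hn
    exact_mod_cast (by omega : 0 < k * n + d - 1)
  have hn' : (0 : ℝ) < n := by exact_mod_cast hn
  simp only [Function.comp_apply]
  rw [div_pow]
  field_simp

theorem samuelMult₀_originIdeal_pow {d : ℕ} (hd : 1 ≤ d) (k : ℕ) :
    samuelMult₀ (originIdeal d ^ k) = (k : ℝ≥0∞) ^ d := by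
  refine Tendsto.limsup_eq ?_
  simp only [length_localization_quot_originIdeal_pow, card_degree_lt _ _ hd]
  have h := ENNReal.tendsto_ofReal (tendsto_choose_div_pow d k hd)
  rw [ENNReal.ofReal_pow (by positivity), ENNReal.ofReal_natCast] at h
  refine h.congr' ?_
  filter_upwards [eventually_gt_atTop 0] with n hn
  have hn' : (0 : ℝ) < n := by exact_mod_cast hn
  rw [ENNReal.ofReal_div_of_pos (by positivity), ENNReal.ofReal_div_of_pos (by positivity),
    ENNReal.ofReal_pow (by positivity)]
  simp

/-! ### Closed convex cones spanned by integral vectors -/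

theorem exists_int_div_mem {ρ : ℕ} {V : Set (Fin ρ → ℝ)} (hV : IsOpen V) (hne : V.Nonempty) :
    ∃ (v : Fin ρ → ℤ) (q : ℕ), 0 < q ∧ (fun i => (v i : ℝ) / q) ∈ V := by
  obtain ⟨r, hr⟩ := (DenseRange.piMap fun _ : Fin ρ =>
    Rat.denseRange_cast (𝕜 := ℝ)).exists_mem_open hV hne
  refine ⟨fun i => (r i).num * ∏ j ∈ Finset.univ.erase i, ((r j).den : ℤ), ∏ j, (r j).den,
    Finset.prod_pos fun j _ => (r j).pos, ?_⟩
  convert hr using 1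
  funext i
  have hden : ∀ j, ((r j).den : ℝ) ≠ 0 := fun j => by exact_mod_cast (r j).den_nz
  have hP : ∏ j ∈ Finset.univ.erase i, ((r j).den : ℝ) ≠ 0 :=
    Finset.prod_ne_zero_iff.2 fun j _ => hden j
  rw [← Finset.mul_prod_erase _ _ (Finset.mem_univ i)]
  push_cast
  rw [mul_div_mul_right _ _ hP]
  exact (Rat.cast_def (r i)).symm

/-- An open cone is contained in the closed convex cone spanned by its integral vectors, because its
rational points are dense and are multiples of integral vectors. -/
theorem subset_closedConeSpan {ρ : ℕ} {C U : Set (Fin ρ → ℝ)} {S : Set (Fin ρ → ℤ)}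
    (hU : IsOpen U) (hsmul : ∀ q : ℕ, 0 < q → ∀ p ∈ U, (q : ℝ) • p ∈ U) (hC : C ⊆ closure U)
    (hS : ∀ v : Fin ρ → ℤ, (fun i => (v i : ℝ)) ∈ U → v ∈ S) : C ⊆ closedConeSpan S := by
  refine hC.trans (closure_minimal (fun p hp => mem_closure_iff.2 fun o ho hpo => ?_)
    isClosed_closure)
  obtain ⟨v, q, hq, hv⟩ := exists_int_div_mem (ho.inter hU) ⟨p, hpo, hp⟩
  have hq' : (q : ℝ) ≠ 0 := by positivity
  have hvS : v ∈ S := hS v <| by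
    convert hsmul q hq _ hv.2 using 1
    funext i
    simp [mul_div_cancel₀ _ hq']
  have hmem : (q : ℝ)⁻¹ • (fun i => (v i : ℝ)) ∈
      PointedCone.hull ℝ ((fun (v : Fin ρ → ℤ) (i : Fin ρ) => (v i : ℝ)) '' S) :=
    PointedCone.smul_mem _ (by positivity) (PointedCone.subset_hull (mem_image_of_mem _ hvS))
  have hdiv : (fun i => (v i : ℝ) / q) = (q : ℝ)⁻¹ • (fun i => (v i : ℝ)) := by
    funext i
    simp [div_eq_inv_mul]
  exact ⟨_, hv.1, hdiv ▸ hmem⟩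

/-! ### The graded system attached to a cone function -/

/-- The signed height `f x - y` of the graph of `f` above the point `(x, y)`. -/
def epiGap {n : ℕ} (f : (Fin n → ℝ) → ℝ) (p : Fin (n + 1) → ℝ) : ℝ :=
  f (Fin.init p) - p (Fin.last n)

/-- Raising `y` moves a point of the epigraph into its interior. -/
theorem epiCone_subset_closure_epiGap_neg {n : ℕ} (f : (Fin n → ℝ) → ℝ) :
    epiCone f ⊆ closure {p | epiGap f p < 0} := by
  intro p hp
  have hlim : Tendsto (fun t : ℝ => p + t • (Pi.single (Fin.last n) 1 : Fin (n + 1) → ℝ))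
      (𝓝[>] 0) (𝓝 p) := by
    have h : Continuous fun t : ℝ => p + t • (Pi.single (Fin.last n) 1 : Fin (n + 1) → ℝ) := by
      fun_prop
    simpa using (h.tendsto 0).mono_left nhdsWithin_le_nhds
  refine mem_closure_of_tendsto hlim (eventually_mem_nhdsWithin.mono fun t ht => ?_)
  have hinit : Fin.init (p + t • (Pi.single (Fin.last n) 1 : Fin (n + 1) → ℝ)) = Fin.init p := by
    funext i
    simp [Fin.init, (Fin.castSucc_lt_last i).ne]
  have hp' : f (Fin.init p) ≤ p (Fin.last n) := hp
  have ht' : 0 < t := ht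
  simp only [mem_ofPred_eq, epiGap, hinit, Pi.add_apply, Pi.smul_apply, Pi.single_eq_same,
    smul_eq_mul, mul_one]
  linarith

/-- For `s ≤ 0` both sides vanish, the exponent `⌈m s⌉` being cut off at `0`. -/
theorem tendsto_toNat_ceil_div (s : ℝ) :
    Tendsto (fun m : ℕ => ((⌈(m : ℝ) * s⌉.toNat : ℕ) : ℝ≥0∞) / m) atTop (𝓝 (ENNReal.ofReal s)) := by
  have hs : (0 : ℝ) ≤ max s 0 := le_max_right s 0
  have h := ENNReal.tendsto_ofReal ((tendsto_nat_ceil_mul_div_atTop hs).comp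
    (tendsto_natCast_atTop_atTop (R := ℝ)))
  rw [ENNReal.ofReal_max, ENNReal.ofReal_zero,
      max_eq_left (zero_le : (0 : ℝ≥0∞) ≤ _)] at h
  refine h.congr' ?_
  filter_upwards [eventually_gt_atTop 0] with m hm
  have hm' : (0 : ℝ) < m := by exact_mod_cast hm
  have hceil : ⌈max s 0 * (m : ℝ)⌉₊ = ⌈(m : ℝ) * s⌉.toNat := by
    rw [Int.ceil_toNat, mul_comm, mul_max_of_nonneg _ _ hm'.le, mul_zero]
    rcases le_total ((m : ℝ) * s) 0 with h | h
    · simp [max_eq_right h, Nat.ceil_eq_zero.2 h]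
    · rw [max_eq_left h]
  simp only [Function.comp_apply]
  rw [hceil, ENNReal.ofReal_div_of_pos hm', ENNReal.ofReal_natCast, ENNReal.ofReal_natCast]

namespace IsConeFunction

variable {n : ℕ} {f : (Fin n → ℝ) → ℝ}

theorem continuous (hf : IsConeFunction f) : Continuous f :=
  continuousOn_univ.1 (hf.convex.continuousOn isOpen_univ)

theorem continuous_epiGap (hf : IsConeFunction f) : Continuous (epiGap f) :=
  (hf.continuous.comp (by unfold Fin.init; fun_prop)).sub (continuous_apply _)

theorem epiGap_smul (hf : IsConeFunction f) {t : ℝ} (ht : 0 ≤ t) (p : Fin (n + 1) → ℝ) :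
    epiGap f (t • p) = t * epiGap f p := by
  have h : Fin.init (t • p) = t • Fin.init p := rfl
  simp only [epiGap, h, hf.homogeneous t _ ht, Pi.smul_apply, smul_eq_mul]
  ring

theorem epiGap_add_le (hf : IsConeFunction f) (p p' : Fin (n + 1) → ℝ) :
    epiGap f (p + p') ≤ epiGap f p + epiGap f p' := by
  -- By homogeneity, convexity at the midpoint is subadditivity.
  have h : Fin.init (p + p') =
      (2 : ℝ) • ((1 / 2 : ℝ) • Fin.init p + (1 / 2 : ℝ) • Fin.init p') := by
    rw [← smul_add, smul_smul]
    norm_num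
    rfl
  have h2 := hf.convex.2 (mem_univ (Fin.init p)) (mem_univ (Fin.init p'))
    (show (0 : ℝ) ≤ 1 / 2 by norm_num) (show (0 : ℝ) ≤ 1 / 2 by norm_num) (by norm_num)
  simp only [smul_eq_mul] at h2
  simp only [epiGap, h, hf.homogeneous 2 _ zero_le_two, Pi.add_apply]
  linarith

theorem epiGap_zero (hf : IsConeFunction f) : epiGap f 0 = 0 := by
  simpa using hf.epiGap_smul le_rfl 0

theorem epiGap_natCast_smul (hf : IsConeFunction f) (m : ℕ) (v : Fin (n + 1) → ℤ) :
    epiGap f (fun i => ((m • v) i : ℝ)) = m * epiGap f (fun i => (v i : ℝ)) := by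
  rw [← hf.epiGap_smul m.cast_nonneg]
  congr 1
  funext i
  simp

theorem epiGap_eq_mul_div (hf : IsConeFunction f) {q : ℕ} (hq : 0 < q) (v : Fin (n + 1) → ℤ) :
    epiGap f (fun i => (v i : ℝ)) = q * epiGap f (fun i => (v i : ℝ) / q) := by
  have hq' : (q : ℝ) ≠ 0 := by positivity
  rw [← hf.epiGap_smul q.cast_nonneg]
  congr 1
  funext i
  simp [mul_div_cancel₀ _ hq']

/-- The system `𝔪_•^C`: subadditivity of `f x - y` gives the inclusions between products. -/
def coneSystem (hf : IsConeFunction f) (d : ℕ) : GradedSystem (n + 1) (AffRing d) where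
  ideal v := originIdeal d ^ ⌈epiGap f fun i => (v i : ℝ)⌉.toNat
  mul_le v w := by
    rw [← pow_add]
    refine Ideal.pow_le_pow_right ?_
    have h := hf.epiGap_add_le (fun i => (v i : ℝ)) (fun i => (w i : ℝ))
    have e : (fun i => ((v + w) i : ℝ)) = (fun i => (v i : ℝ)) + fun i => (w i : ℝ) := by
      funext i; simp
    rw [e]
    have h1 := (Int.ceil_mono h).trans (Int.ceil_add_le _ _)
    omega

theorem isConeSystem_coneSystem (hf : IsConeFunction f) (d : ℕ) :
    IsConeSystem f (hf.coneSystem d) := fun _ => rfl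

theorem coneSystem_ideal_nsmul (hf : IsConeFunction f) {d : ℕ} (m : ℕ) (v : Fin (n + 1) → ℤ) :
    (hf.coneSystem d).ideal (m • v) =
      originIdeal d ^ ⌈(m : ℝ) * epiGap f fun i => (v i : ℝ)⌉.toNat := by
  rw [← hf.epiGap_natCast_smul]
  rfl

theorem coneSystem_ideal_eq_top_iff (hf : IsConeFunction f) {d : ℕ} (hd : 1 ≤ d)
    (v : Fin (n + 1) → ℤ) : (hf.coneSystem d).ideal v = ⊤ ↔ epiGap f (fun i => (v i : ℝ)) ≤ 0 := by
  rw [coneSystem, originIdeal_pow_eq_top_iff hd, Int.toNat_eq_zero, Int.ceil_le, Int.cast_zero]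

theorem nef_coneSystem (hf : IsConeFunction f) {d : ℕ} (hd : 1 ≤ d) :
    (hf.coneSystem d).nef = epiCone f := by
  have hepi : epiCone f = {p | epiGap f p ≤ 0} := by
    ext p
    exact (sub_nonpos (a := f (Fin.init p))).symm
  refine Subset.antisymm (closure_minimal (fun p hp => ?_) ?_) ?_
  · rw [hepi]
    induction hp using Submodule.span_induction with
    | mem p hp =>
      obtain ⟨v, hv, rfl⟩ := hp
      exact (hf.coneSystem_ideal_eq_top_iff hd v).1 hv
    | zero => exact hf.epiGap_zero.le
    | add p p' _ _ hp hp' => exact (hf.epiGap_add_le p p').trans (add_nonpos hp hp')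
    | smul c p _ hp =>
      exact (hf.epiGap_smul c.2 p).trans_le (mul_nonpos_of_nonneg_of_nonpos c.2 hp)
  · rw [hepi]
    exact isClosed_le hf.continuous_epiGap continuous_const
  · refine subset_closedConeSpan (isOpen_lt hf.continuous_epiGap continuous_const)
      (fun q hq p hp => ?_) (epiCone_subset_closure_epiGap_neg f) fun v hv => ?_
    · exact (hf.epiGap_smul q.cast_nonneg p).trans_lt
        (mul_neg_of_pos_of_neg (by exact_mod_cast hq) hp)
    · exact (hf.coneSystem_ideal_eq_top_iff hd v).2 (le_of_lt hv)

theorem big_coneSystem (hf : IsConeFunction f) {d : ℕ} (hd : 1 ≤ d) :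
    (hf.coneSystem d).big = univ := by
  have h : (hf.coneSystem d).eff = univ := univ_subset_iff.1 <|
    subset_closedConeSpan isOpen_univ (fun _ _ _ _ => mem_univ _) subset_closure
      fun v _ => originIdeal_pow_ne_bot hd _
  rw [GradedSystem.big, h, interior_univ]

theorem big_diff_nef_coneSystem (hf : IsConeFunction f) {d : ℕ} (hd : 1 ≤ d) :
    (hf.coneSystem d).big \ (hf.coneSystem d).nef = {p | 0 < epiGap f p} := by
  rw [hf.big_coneSystem hd, hf.nef_coneSystem hd]
  ext p
  simp [epiCone, epiGap]

/-! ### The asymptotic invariants -/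

/-- An invariant with `φ (𝔪 ^ k) = c k ^ e` has asymptotic value `c (f x - y) ^ e` above the nef
cone, and vanishes on the nef cone. -/
theorem isAsymptotic_coneSystem (hf : IsConeFunction f) {d : ℕ}
    {φ : Ideal (AffRing d) → ℝ≥0∞} {c : ℝ} {e : ℕ}
    (hc : 0 ≤ c) (hφ : ∀ k : ℕ, φ (originIdeal d ^ k) = ENNReal.ofReal c * (k : ℝ≥0∞) ^ e)
    (D : Set (Fin (n + 1) → ℝ)) :
    (hf.coneSystem d).IsAsymptotic φ e D fun p => c * (max (epiGap f p) 0) ^ e where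
  continuousOn := by
    have := hf.continuous_epiGap
    exact Continuous.continuousOn (by fun_prop)
  nonneg p _ := by positivity
  tendsto v q hq _ := by
    have hval : ENNReal.ofReal ((q : ℝ) ^ e *
        (c * (max (epiGap f fun i => (v i : ℝ) / q) 0) ^ e)) =
        ENNReal.ofReal c * ENNReal.ofReal (epiGap f fun i => (v i : ℝ)) ^ e := by
      rw [mul_left_comm, ← mul_pow, mul_max_of_nonneg _ _ q.cast_nonneg, mul_zero,
        ← hf.epiGap_eq_mul_div hq, ENNReal.ofReal_mul hc, ENNReal.ofReal_pow (le_max_right _ _),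
        ENNReal.ofReal_max, ENNReal.ofReal_zero,
      max_eq_left (zero_le : (0 : ℝ≥0∞) ≤ _)]
    rw [hval]
    refine (ENNReal.Tendsto.const_mul ((ENNReal.continuous_pow e).tendsto _ |>.comp
      (tendsto_toNat_ceil_div (epiGap f fun i => (v i : ℝ))))
      (Or.inr ENNReal.ofReal_ne_top)).congr fun m => ?_
    rw [hf.coneSystem_ideal_nsmul, hφ, Function.comp_apply, mul_div_assoc, div_eq_mul_inv,
      div_eq_mul_inv, mul_pow, ENNReal.inv_pow]

theorem eventually_radical_coneSystem (hf : IsConeFunction f) {d : ℕ} {v : Fin (n + 1) → ℤ}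
    (hv : 0 < epiGap f fun i => (v i : ℝ)) :
    ∀ᶠ m : ℕ in atTop, ((hf.coneSystem d).ideal (m • v)).radical = originIdeal d := by
  filter_upwards [eventually_gt_atTop 0] with m hm
  rw [hf.coneSystem_ideal_nsmul]
  refine radical_originIdeal_pow d ?_
  have : 0 < ⌈(m : ℝ) * epiGap f fun i => (v i : ℝ)⌉ := Int.ceil_pos.2 (by positivity)
  omega

end IsConeFunction

/-- A root of `c (f x - y) ^ e` is smooth wherever it is positive, and its restriction to a slice
`y = const` is `f` up to a constant. -/
theorem nowhereSmoothOn_epiGap_pow {n : ℕ} {f : (Fin n → ℝ) → ℝ} (hf : NowhereSmoothOn f univ)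
    {c : ℝ} (hc : 0 < c) {e : ℕ} (he : e ≠ 0) :
    NowhereSmoothOn (fun p => c * (max (epiGap f p) 0) ^ e) {p | 0 < epiGap f p} := by
  rintro W hW ⟨p, hp⟩ hWD hF
  let ι : (Fin n → ℝ) → (Fin (n + 1) → ℝ) := fun x => Fin.snoc (α := fun _ => ℝ) x (p (Fin.last n))
  have hι : ContDiff ℝ ((⊤ : ℕ∞) : WithTop ℕ∞) ι := by
    refine contDiff_pi.2 fun i => ?_
    induction i using Fin.lastCases with
    | last => simpa [ι] using contDiff_const
    | cast i => simpa [ι] using contDiff_apply ℝ ℝ i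
  refine hf (ι ⁻¹' W) (hW.preimage hι.continuous) ⟨Fin.init p, by simpa [ι] using hp⟩
    (subset_univ _) ?_
  have hroot : ContDiffOn ℝ ((⊤ : ℕ∞) : WithTop ℕ∞)
      (fun p => (c⁻¹ * (c * (max (epiGap f p) 0) ^ e)) ^ ((e : ℝ)⁻¹)) W := by
    refine (contDiffOn_const.mul hF).rpow_const_of_ne fun p hp => ?_
    have : 0 < max (epiGap f p) 0 := lt_max_of_lt_left (hWD hp)
    positivity
  refine ((hroot.comp hι.contDiffOn fun x hx => hx).add
    (contDiffOn_const (c := p (Fin.last n)))).congr fun x hx => ?_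
  have hpos : 0 < epiGap f (ι x) := hWD hx
  simp only [Function.comp_apply]
  rw [inv_mul_cancel_left₀ hc.ne', max_eq_left hpos.le, Real.pow_rpow_inv_natCast hpos.le he]
  simp [epiGap, ι]

theorem corollary2 (d : ℕ) (hd : 1 ≤ d) :
    -- existence of the functions `f` (already on `ℝ²`)
    (∃ f : (Fin 2 → ℝ) → ℝ, IsConeFunction f ∧
      ∀ W : Set (Fin 2 → ℝ), IsOpen W → W.Nonempty → ¬ DifferentiableOn ℝ f W) ∧
    -- the graded systems attached to such functions
    (∀ (n : ℕ) (f : (Fin n → ℝ) → ℝ), IsConeFunction f → NowhereSmoothOn f univ →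
      ∃ a : GradedSystem (n + 1) (AffRing d), IsConeSystem f a ∧
        a.nef = epiCone f ∧ a.big = univ ∧
        IsOpen (a.big \ a.nef) ∧ (a.big \ a.nef).Nonempty ∧
        (∃ F, a.IsAsymptoticOrd F ∧
          (∀ p ∈ a.big \ a.nef, F p = f (Fin.init p) - p (Fin.last n)) ∧
          NowhereSmoothOn F (a.big \ a.nef)) ∧
        (∃ F, a.IsAsymptoticArn F ∧
          (∀ p ∈ a.big \ a.nef, F p = (f (Fin.init p) - p (Fin.last n)) / d) ∧
          NowhereSmoothOn F (a.big \ a.nef)) ∧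
        (∃ F, a.IsAsymptoticMult (a.big \ a.nef) F ∧
          (∀ p ∈ a.big \ a.nef, F p = (f (Fin.init p) - p (Fin.last n)) ^ d) ∧
          NowhereSmoothOn F (a.big \ a.nef))) := by
  refine ⟨⟨kinkFun, isConeFunction_kinkFun, not_differentiableOn_kinkFun⟩, fun n f hf hns => ?_⟩
  have hd' : (0 : ℝ) < d := by exact_mod_cast hd
  have hmax : ∀ p, 0 < epiGap f p → max (epiGap f p) 0 = f (Fin.init p) - p (Fin.last n) :=
    fun p hp => max_eq_left hp.le
  refine ⟨hf.coneSystem d, hf.isConeSystem_coneSystem d, hf.nef_coneSystem hd,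
    hf.big_coneSystem hd, ?_⟩
  rw [hf.big_diff_nef_coneSystem hd]
  refine ⟨isOpen_lt continuous_const hf.continuous_epiGap, ?_,
    ⟨_, hf.isAsymptotic_coneSystem zero_le_one (fun k => ?_) _, fun p hp => ?_,
      nowhereSmoothOn_epiGap_pow hns one_pos one_ne_zero⟩,
    ⟨_, hf.isAsymptotic_coneSystem (inv_pos.2 hd').le (fun k => ?_) _, fun p hp => ?_,
      nowhereSmoothOn_epiGap_pow hns (inv_pos.2 hd') one_ne_zero⟩,
    ⟨_, ⟨fun v q hq hv => hf.eventually_radical_coneSystem ?_,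
      hf.isAsymptotic_coneSystem zero_le_one (fun k => ?_) _⟩, fun p hp => ?_,
      nowhereSmoothOn_epiGap_pow hns one_pos (by omega)⟩⟩
  · refine ⟨Pi.single (Fin.last n) (-1), ?_⟩
    have hinit : Fin.init (Pi.single (Fin.last n) (-1) : Fin (n + 1) → ℝ) = 0 := by
      funext i
      simp [Fin.init, (Fin.castSucc_lt_last i).ne]
    have h0 : f 0 = 0 := by simpa using hf.homogeneous 0 0 le_rfl
    simp [epiGap, hinit, h0]
  · simp [ord₀_originIdeal_pow hd]
  · simp [hmax p hp]
  · rw [arn_originIdeal_pow hd, ENNReal.ofReal_inv_of_pos hd', ENNReal.ofReal_natCast, pow_one,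
      div_eq_mul_inv, mul_comm]
  · simp [hmax p hp, div_eq_inv_mul]
  · rw [hf.epiGap_eq_mul_div hq]
    exact mul_pos (by exact_mod_cast hq) hv
  · simp [samuelMult₀_originIdeal_pow hd]
  · simp [hmax p hp]

end
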